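/- Conventions. Let $A_0,A_1$ be quasi-normed spaces (over $\mathbb R$ or $\mathbb C$) forming a compatible couple, i.e. both are continuously embedded in one Hausdorff topological vector space. For $f\in A_0+A_1$ and $t>0$ put $$K(t,f)=K(t,f;A_0,A_1)=\inf\{\|f_0\|_{A_0}+t\|f_1\|_{A_1}:\ f=f_0+f_1,\ f_0\in A_0,\ f_1\in A_1\},$$ with $\inf\emptyset=\infty$ when $K(\cdot,f;X_0,X_1)$ is formed for $f\notin X_0+X_1$. The couple is $K$-surjective if for every quasi-concave $\phi:(0,\infty)\to(0,\infty)$ (i.e. $\phi(t)$ and $t\phi(1/t)$ are non-decreasing) there are $f\in A_0+A_1$ and constants $c,C>0$ with $c\,\phi(t)\le K(t,f)\le C\,\phi(t)$ for all $t>0$. A Lebesgue measurable $b:(0,\infty)\to(0,\infty)$ is slowly varying, $b\in SV$, if for every $\varepsilon>0$ there are positive functions $g_\varepsilon$ (non-decreasing) and $g_{-\varepsilon}$ (non-increasing) on $(0,\infty)$ such that each of the quotients $t^{\varepsilon}b(t)/g_\varepsilon(t)$ and $t^{-\varepsilon}b(t)/g_{-\varepsilon}(t)$ lies between two positive constants for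 all $t>0$. For $0<q\le\infty$, $\bar A_{\theta,q;b}$ is the space of all $f\in A_0+A_1$ with finite quasi-norm $\|f\|_{\bar A_{\theta,q;b}}=\|u^{-\theta-1/q}b(u)K(u,f)\|_{L^q(0,\infty)}$ (with $1/q=0$ for $q=\infty$). Theorem. Let $0<\theta<1$, let $0<q_0,q_1\le\infty$ with $q_0\ne q_1$, let $b_0,b_1\in SV$, and let $(A_0,A_1)$ be $K$-surjective. Then there is no positive function $w$ on $(0,\infty)$ for which there exists a constant $c>0$ such that, for all $f\in A_0+A_1$ and all $t>0$, $$K\big(w(t),f;\bar A_{\theta,q_0;b_0},\bar A_{\theta,q_1;b_1}\big)\ \ge\ c\left(\big\|u^{-\theta-1/q_0}b_0(u)K(u,f)\big\|_{L^{q_0}(0,t)}+w(t)\,\big\|u^{-\theta-1/q_1}b_1(u)K(u,f)\big\|_{L^{q_1}(t,\infty)}\right).$$ -/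

import Mathlib

open MeasureTheory Set
open scoped ENNReal

namespace KInterpolation

/-- A quasi-normed space over `𝕜` which is continuously embedded in the topological vector space
`V` (it is identified with its image, a subspace of `V` carrying its own quasi-norm). A compatible
couple is a pair of these in one and the same Hausdorff topological vector space `V`. -/
structure QuasiNormedSubspace (𝕜 V : Type*) [RCLike 𝕜] [AddCommGroup V] [Module 𝕜 V]
    [TopologicalSpace V] where
  carrier : Submodule 𝕜 V
  qnorm : carrier → ℝ
  qnorm_nonneg : ∀ x, 0 ≤ qnorm x
  qnorm_eq_zero_iff : ∀ x, qnorm x = 0 ↔ x = 0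
  qnorm_smul : ∀ (a : 𝕜) (x : carrier), qnorm (a • x) = ‖a‖ * qnorm x
  qnorm_add_le : ∃ C : ℝ, ∀ x y, qnorm (x + y) ≤ C * (qnorm x + qnorm y)
  continuous_incl : ∀ U ∈ nhds (0 : V), ∃ δ : ℝ, 0 < δ ∧ ∀ x, qnorm x < δ → (x : V) ∈ U

open Classical in
/-- The quasi-norm of `A`, extended by `∞` to the elements of `V` outside `A`. -/
noncomputable def QuasiNormedSubspace.extNorm {𝕜 V : Type*} [RCLike 𝕜] [AddCommGroup V]
    [Module 𝕜 V] [TopologicalSpace V] (A : QuasiNormedSubspace 𝕜 V) (f : V) : ℝ≥0∞ :=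
  if h : f ∈ A.carrier then ENNReal.ofReal (A.qnorm ⟨f, h⟩) else ∞

/-- The `K`-functional `K(t, f) = inf {N₀ f₀ + t N₁ f₁ : f = f₀ + f₁}`, `t > 0`, of two spaces given
by their extended quasi-norms `N₀`, `N₁`, which are `∞` outside the spaces: decompositions
with `f₀` or `f₁` outside the respective space contribute `∞`, so that the infimum is the one
over the `f₀`, `f₁` in the spaces. It is `∞` if `f` has no such decomposition. -/
noncomputable def K {V : Type*} [AddCommGroup V] (N₀ N₁ : V → ℝ≥0∞) (t : ℝ) (f : V) : ℝ≥0∞ :=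
  ⨅ (f₀ : V) (f₁ : V) (_ : f = f₀ + f₁), N₀ f₀ + ENNReal.ofReal t * N₁ f₁

/-- `F ≈ G` on `(0, ∞)` for real functions. -/
def Approx (F G : ℝ → ℝ) : Prop :=
  ∃ c : ℝ, 0 < c ∧ ∃ C : ℝ, 0 < C ∧ ∀ t : ℝ, 0 < t → c * G t ≤ F t ∧ F t ≤ C * G t

/-- The class `SV` of slowly varying functions on `(0, ∞)` (values off `(0, ∞)` are irrelevant). -/
structure SlowlyVarying (b : ℝ → ℝ) : Prop where
  aemeasurable : AEMeasurable b (volume.restrict (Ioi 0))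
  pos : ∀ t : ℝ, 0 < t → 0 < b t
  exists_monotone : ∀ ε : ℝ, 0 < ε → ∃ g : ℝ → ℝ, (∀ t : ℝ, 0 < t → 0 < g t) ∧ MonotoneOn g (Ioi 0) ∧
    Approx (fun t => t ^ ε * b t) g
  exists_antitone : ∀ ε : ℝ, 0 < ε → ∃ g : ℝ → ℝ, (∀ t : ℝ, 0 < t → 0 < g t) ∧ AntitoneOn g (Ioi 0) ∧
    Approx (fun t => t ^ (-ε) * b t) g

/-- Quasi-concave functions `φ : (0, ∞) → (0, ∞)`. -/
structure QuasiConcave (φ : ℝ → ℝ) : Prop where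
  pos : ∀ t : ℝ, 0 < t → 0 < φ t
  monotone : MonotoneOn φ (Ioi 0)
  monotone_conj : MonotoneOn (fun t => t * φ (1 / t)) (Ioi 0)

/-- `‖u^(-θ - 1/q) b(u) k(u)‖` in `L^q(S)`, for a function `k` with values in `[0, ∞]`;
`1/q` is `0` for `q = ∞`. -/
noncomputable def weightedNorm (θ : ℝ) (q : ℝ≥0∞) (b : ℝ → ℝ) (k : ℝ → ℝ≥0∞) (S : Set ℝ) : ℝ≥0∞ :=
  eLpNorm (fun u => ENNReal.ofReal (u ^ (-θ - 1 / q.toReal) * b u) * k u) q (volume.restrict S)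

section Couple

variable {𝕜 V : Type*} [RCLike 𝕜] [AddCommGroup V] [Module 𝕜 V] [TopologicalSpace V]

/-- `K(t, f; A₀, A₁)`. -/
noncomputable def coupleK (A₀ A₁ : QuasiNormedSubspace 𝕜 V) (t : ℝ) (f : V) : ℝ≥0∞ :=
  K A₀.extNorm A₁.extNorm t f

/-- The extended quasi-norm of the `K`-interpolation space `(A₀, A₁)_{θ,q;b}`; the space consists
of the `f` for which it is finite (these lie in `A₀ + A₁`, as `K(t, f; A₀, A₁) = ∞` otherwise). -/
noncomputable def interpNorm (A₀ A₁ : QuasiNormedSubspace 𝕜 V) (θ : ℝ) (q : ℝ≥0∞) (b : ℝ → ℝ)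
    (f : V) : ℝ≥0∞ :=
  weightedNorm θ q b (fun u => coupleK A₀ A₁ u f) (Ioi 0)

/-- `K`-surjective couples: every quasi-concave function is equivalent to some `K(·, f)`,
`f ∈ A₀ + A₁`. -/
def KSurjective (A₀ A₁ : QuasiNormedSubspace 𝕜 V) : Prop :=
  ∀ φ : ℝ → ℝ, QuasiConcave φ → ∃ f ∈ A₀.carrier ⊔ A₁.carrier,
    ∃ c : ℝ, 0 < c ∧ ∃ C : ℝ, 0 < C ∧ ∀ t : ℝ, 0 < t →
      ENNReal.ofReal (c * φ t) ≤ coupleK A₀ A₁ t f ∧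
      coupleK A₀ A₁ t f ≤ ENNReal.ofReal (C * φ t)

end Couple

end KInterpolation

/-! The trivial decompositions `f = f + 0` and `f = 0 + f` turn the assumed estimate into two
one-sided bounds: `w t` times the `(q₁, b₁)`-norm of `K(·, f)` on `(t, ∞)` is controlled by the
`(q₀, b₀)`-norm on `(0, ∞)`, and `(w t)⁻¹` times the `(q₀, b₀)`-norm on `(0, t)` by the `(q₁,
b₁)`-norm.

By `K`-surjectivity, `K(·, f)` may be replaced by any quasi-concave `φ`, but with equivalence
constants depending on `φ`. A gliding-hump argument (`exists_uniform_bound`) makes the constants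
uniform.

The bounds are then tested on `φ` comparable to `u ^ θ / b u` on `(a, a e^L)` with norm of order `L
^ (1/q)` (`exists_quasiConcave_plateau`). Put `ρ = b₀ / b₁`. With `L = 1` they give `w t ≲ ρ s` for
`t ≤ s` and `ρ s ≲ w t` for `s ≤ t`, so `w ≈ ρ` is almost increasing. With `L` large and `α = |1/q₀
- 1/q₁| > 0` they give `ρ a * L ^ α ≲ ρ (a e^L)`. Iterated at a fixed large `L`, this is power
growth, impossible for a quotient of slowly varying functions (`not_rpow_growth`). -/

namespace KInterpolation

/-! ### Weighted `L^q` norms. -/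

section WeightedNorm

variable {θ : ℝ} {q : ℝ≥0∞} {b : ℝ → ℝ}

theorem weightedNorm_mono_set (k : ℝ → ℝ≥0∞) {S T : Set ℝ} (h : S ⊆ T) :
    weightedNorm θ q b k S ≤ weightedNorm θ q b k T :=
  eLpNorm_mono_measure _ (Measure.restrict_mono h le_rfl)

theorem weightedNorm_le_mul {k k' : ℝ → ℝ≥0∞} {S : Set ℝ} (hS : MeasurableSet S) (c : ℝ)
    (h : ∀ u ∈ S, k u ≤ ENNReal.ofReal c * k' u) :
    weightedNorm θ q b k S ≤ ENNReal.ofReal c * weightedNorm θ q b k' S := by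
  have := eLpNorm_le_nnreal_smul_eLpNorm_of_ae_le_mul' (μ := volume.restrict S)
    (f := fun u => ENNReal.ofReal (u ^ (-θ - 1 / q.toReal) * b u) * k u)
    (g := fun u => ENNReal.ofReal (u ^ (-θ - 1 / q.toReal) * b u) * k' u) (c := c.toNNReal)
    (ae_restrict_of_forall_mem hS fun u hu => by
      simp only [enorm_eq_self]
      calc _ ≤ ENNReal.ofReal (u ^ (-θ - 1 / q.toReal) * b u) * (ENNReal.ofReal c * k' u) := by
            gcongr; exact h u hu
        _ = _ := by rw [mul_left_comm]; rfl) q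
  exact this

theorem weightedNorm_pos (hb : SlowlyVarying b) (hq : q ≠ 0) (a : ℝ) (ha : 0 ≤ a) :
    weightedNorm θ q b (fun _ => 1) (Ioi a) ≠ 0 := by
  have hba : AEMeasurable b (volume.restrict (Ioi a)) :=
    hb.aemeasurable.mono_measure (Measure.restrict_mono (Ioi_subset_Ioi ha) le_rfl)
  have hm : AEMeasurable (fun u => ENNReal.ofReal (u ^ (-θ - 1 / q.toReal) * b u) * 1)
      (volume.restrict (Ioi a)) :=
    (((measurable_id.pow_const _).aemeasurable.mul hba).ennreal_ofReal).mul aemeasurable_const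
  rw [weightedNorm, Ne, eLpNorm_eq_zero_iff hm.aestronglyMeasurable hq]
  intro h
  have h' : ∀ᵐ u ∂(volume.restrict (Ioi a)), False := by
    filter_upwards [h, ae_restrict_mem measurableSet_Ioi] with u hu hu'
    have hu0 : 0 < u := ha.trans_lt hu'
    have := mul_pos (Real.rpow_pos_of_pos hu0 (-θ - 1 / q.toReal)) (hb.pos u hu0)
    simp only [mul_one, Pi.zero_apply, ENNReal.ofReal_eq_zero] at hu
    linarith
  rw [Filter.eventually_false_iff_eq_bot, ae_eq_bot, Measure.restrict_eq_zero] at h'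
  simp at h'

/-- Completeness substitute valid also for `q < 1`: for finite `q` the `q`-th power of a supremum is
at most the sum of the `q`-th powers, and these integrals are dominated by a geometric series. For
`q = ∞` the bound `1` is uniform in `n`. -/
theorem weightedNorm_iSup_ne_top (hb : SlowlyVarying b) (hq : q ≠ 0) (k : ℕ → ℝ → ℝ≥0∞)
    (hk : ∀ n, AEMeasurable (k n) (volume.restrict (Ioi 0)))
    (h : ∀ n, weightedNorm θ q b (k n) (Ioi 0) ≤ 2⁻¹ ^ n) :
    weightedNorm θ q b (fun u => ⨆ n, k n u) (Ioi 0) ≠ ∞ := by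
  set W : ℝ → ℝ≥0∞ := fun u => ENNReal.ofReal (u ^ (-θ - 1 / q.toReal) * b u) with hW
  have hWm : AEMeasurable W (volume.restrict (Ioi 0)) :=
    ((measurable_id.pow_const _).aemeasurable.mul hb.aemeasurable).ennreal_ofReal
  change eLpNorm (fun u => W u * ⨆ n, k n u) q (volume.restrict (Ioi 0)) ≠ ∞
  have h1 : ∀ n, eLpNorm (fun u => W u * k n u) q (volume.restrict (Ioi 0)) ≤ 2⁻¹ ^ n := h
  rcases eq_or_ne q ∞ with rfl | hqt
  · simp only [eLpNorm_exponent_top] at h1 ⊢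
    refine ((eLpNormEssSup_le_of_ae_enorm_bound (C := 1) ?_).trans_lt ENNReal.one_lt_top).ne
    have : ∀ᵐ u ∂(volume.restrict (Ioi 0)), ∀ n, W u * k n u ≤ 1 := by
      rw [ae_all_iff]
      intro n
      filter_upwards [ae_le_eLpNormEssSup (f := fun u => W u * k n u)
        (μ := volume.restrict (Ioi 0))] with u hu
      exact hu.trans ((h1 n).trans (pow_le_one₀ zero_le (by simp)))
    filter_upwards [this] with u hu
    rw [enorm_eq_self, ENNReal.mul_iSup]
    exact iSup_le hu
  · have hp : 0 < q.toReal := ENNReal.toReal_pos hq hqt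
    refine ((eLpNorm_lt_top_iff_lintegral_rpow_enorm_lt_top hq hqt).2 ?_).ne
    have h2 : ∀ n, ∫⁻ u in Ioi 0, (W u * k n u) ^ q.toReal ≤ (2⁻¹ ^ n) ^ q.toReal := by
      intro n
      have := h1 n
      rw [eLpNorm_eq_lintegral_rpow_enorm_toReal hq hqt, one_div,
        ENNReal.rpow_inv_le_iff hp] at this
      simpa using this
    calc ∫⁻ u in Ioi 0, ‖W u * ⨆ n, k n u‖ₑ ^ q.toReal
        ≤ ∫⁻ u in Ioi 0, ∑' n, (W u * k n u) ^ q.toReal := by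
          refine lintegral_mono fun u => ?_
          rw [enorm_eq_self, ENNReal.mul_iSup, ← ENNReal.le_rpow_inv_iff hp]
          refine iSup_le fun n => ?_
          rw [ENNReal.le_rpow_inv_iff hp]
          exact ENNReal.le_tsum (f := fun n => (W u * k n u) ^ q.toReal) n
      _ = ∑' n, ∫⁻ u in Ioi 0, (W u * k n u) ^ q.toReal :=
          lintegral_tsum fun n => (hWm.mul (hk n)).pow_const _
      _ ≤ ∑' n, (2⁻¹ ^ q.toReal) ^ n := by
          refine ENNReal.tsum_le_tsum fun n => (h2 n).trans (le_of_eq ?_)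
          rw [← ENNReal.rpow_natCast, ← ENNReal.rpow_natCast, ← ENNReal.rpow_mul,
            ← ENNReal.rpow_mul, mul_comm]
      _ < ∞ := by
          rw [ENNReal.tsum_geometric]
          simp only [lt_top_iff_ne_top, ne_eq, ENNReal.inv_eq_top, tsub_eq_zero_iff_le, not_le]
          exact ENNReal.rpow_lt_one (by simp) hp

end WeightedNorm

/-! ### Quasi-concave functions and uniform boundedness. -/

section QuasiConcave

theorem QuasiConcave.iSup {ι : Type*} [Nonempty ι] {φ : ι → ℝ → ℝ}
    (h : ∀ i, QuasiConcave (φ i))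
    (hbdd : ∀ u : ℝ, 0 < u → BddAbove (range fun i => φ i u)) :
    QuasiConcave (fun u => ⨆ i, φ i u) where
  pos t ht := by
    obtain ⟨i⟩ := ‹Nonempty ι›
    exact ((h i).pos t ht).trans_le (le_ciSup (hbdd t ht) i)
  monotone s hs t ht hst := ciSup_mono (hbdd t ht) fun i => (h i).monotone hs ht hst
  monotone_conj s hs t ht hst := by
    have hs' : 0 < s := hs
    have ht' : 0 < t := ht
    simp only [Real.mul_iSup_of_nonneg hs'.le, Real.mul_iSup_of_nonneg ht'.le]
    refine ciSup_mono ?_ fun i => (h i).monotone_conj hs ht hst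
    obtain ⟨M, hM⟩ := hbdd (1 / t) (by positivity)
    refine ⟨t * M, ?_⟩
    rintro _ ⟨i, rfl⟩
    exact mul_le_mul_of_nonneg_left (hM ⟨i, rfl⟩) ht'.le

theorem QuasiConcave.const_mul {φ : ℝ → ℝ} (h : QuasiConcave φ) {c : ℝ} (hc : 0 < c) :
    QuasiConcave (fun u => c * φ u) where
  pos t ht := mul_pos hc (h.pos t ht)
  monotone s hs t ht hst := mul_le_mul_of_nonneg_left (h.monotone hs ht hst) hc.le
  monotone_conj s hs t ht hst := by
    have := mul_le_mul_of_nonneg_left (h.monotone_conj hs ht hst) hc.le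
    simp only at this ⊢
    linarith

theorem quasiConcave_min_one_div {s : ℝ} (hs : 0 < s) : QuasiConcave (fun u => min 1 (u / s)) where
  pos t ht := lt_min one_pos (by positivity)
  monotone u _ v _ huv := min_le_min le_rfl (by gcongr)
  monotone_conj u hu v hv huv := by
    have hu' : 0 < u := hu
    have hv' : 0 < v := hv
    have key : ∀ x : ℝ, 0 < x → x * min 1 (1 / x / s) = min x (1 / s) := fun x hx => by
      rw [mul_min_of_nonneg _ _ hx.le, mul_one]
      congr 1
      field_simp
    simp only [key u hu', key v hv']
    exact min_le_min huv le_rfl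

/-- A uniform boundedness principle: a family of positively homogeneous monotone functionals that
is bounded at every quasi-concave function of finite weighted norm is uniformly bounded in terms of
that norm. -/
theorem exists_uniform_bound {θ : ℝ} {q : ℝ≥0∞} {b : ℝ → ℝ} (hb : SlowlyVarying b) (hq : q ≠ 0)
    {ι : Type*} (T : ι → (ℝ → ℝ≥0∞) → ℝ≥0∞)
    (hmono : ∀ i k k' c, (∀ u : ℝ, 0 < u → k u ≤ ENNReal.ofReal c * k' u) →
      T i k ≤ ENNReal.ofReal c * T i k')
    (hT : ∀ φ, QuasiConcave φ →
      weightedNorm θ q b (fun u => ENNReal.ofReal (φ u)) (Ioi 0) ≠ ∞ →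
      ∃ C : ℝ≥0∞, C ≠ ∞ ∧ ∀ i, T i (fun u => ENNReal.ofReal (φ u)) ≤ C) :
    ∃ C : ℝ, 0 < C ∧ ∀ φ, QuasiConcave φ → ∀ N : ℝ, 0 < N →
      weightedNorm θ q b (fun u => ENNReal.ofReal (φ u)) (Ioi 0) ≤ ENNReal.ofReal N →
      ∀ i, T i (fun u => ENNReal.ofReal (φ u)) ≤ ENNReal.ofReal (C * N) := by
  by_contra! hcon
  -- One factor `2 ^ n` of `4 ^ n` makes the normalised norms at most `2⁻¹ ^ n`; the other still
  -- forces the functionals to blow up.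
  choose φ hφ N hN hφN i hi using fun n : ℕ => hcon (4 ^ n) (by positivity)
  set ψ : ℕ → ℝ → ℝ := fun n u => (2 ^ n * N n)⁻¹ * φ n u with hψ
  have hc : ∀ n, 0 < 2 ^ n * N n := fun n => by have := hN n; positivity
  have hψq : ∀ n, QuasiConcave (ψ n) := fun n => (hφ n).const_mul (inv_pos.2 (hc n))
  have hψn : ∀ n, weightedNorm θ q b (fun u => ENNReal.ofReal (ψ n u)) (Ioi 0) ≤ 2⁻¹ ^ n := by
    intro n
    calc _ ≤ ENNReal.ofReal (2 ^ n * N n)⁻¹ *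
          weightedNorm θ q b (fun u => ENNReal.ofReal (φ n u)) (Ioi 0) :=
        weightedNorm_le_mul measurableSet_Ioi _ fun u _ => by
          rw [hψ, ENNReal.ofReal_mul (inv_pos.2 (hc n)).le]
      _ ≤ ENNReal.ofReal (2 ^ n * N n)⁻¹ * ENNReal.ofReal (N n) := by gcongr; exact hφN n
      _ = ENNReal.ofReal (2⁻¹ ^ n) := by
        rw [← ENNReal.ofReal_mul (inv_pos.2 (hc n)).le]
        have := (hN n).ne'
        rw [inv_pow]
        congr 1
        field_simp
      _ = _ := by
        rw [ENNReal.ofReal_pow (by positivity), ENNReal.ofReal_inv_of_pos two_pos]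
        simp
  -- Monotonicity gives `ψ n v ≥ ψ n u` for `v > u`, so `ψ n u` times the norm of `1` on `(u, ∞)` is
  -- at most the norm of `ψ n`, hence at most `1`.
  have hbdd : ∀ u : ℝ, 0 < u → BddAbove (range fun n => ψ n u) := by
    intro u hu
    set p := weightedNorm θ q b (fun _ => 1) (Ioi u)
    have hp : p ≠ 0 := weightedNorm_pos hb hq u hu.le
    refine ⟨p⁻¹.toReal, ?_⟩
    rintro _ ⟨n, rfl⟩
    have hpos := (hψq n).pos u hu
    have h1 : p ≤ ENNReal.ofReal (ψ n u)⁻¹ := by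
      calc p ≤ ENNReal.ofReal (ψ n u)⁻¹ *
            weightedNorm θ q b (fun u => ENNReal.ofReal (ψ n u)) (Ioi u) :=
          weightedNorm_le_mul measurableSet_Ioi _ fun v hv => by
            have hv' : u < v := hv
            rw [← ENNReal.ofReal_mul (inv_pos.2 hpos).le, ENNReal.one_le_ofReal,
              inv_mul_eq_div, one_le_div hpos]
            exact (hψq n).monotone hu (hu.trans hv') hv'.le
        _ ≤ ENNReal.ofReal (ψ n u)⁻¹ * 1 := by
          gcongr
          exact (weightedNorm_mono_set _ (Ioi_subset_Ioi hu.le)).trans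
            ((hψn n).trans (pow_le_one₀ zero_le (by simp)))
        _ = _ := mul_one _
    rw [ENNReal.ofReal_inv_of_pos hpos, ENNReal.le_inv_iff_le_inv] at h1
    exact (ENNReal.ofReal_le_iff_le_toReal (ENNReal.inv_ne_top.2 hp)).1 h1
  have hsup := QuasiConcave.iSup hψq hbdd
  have hle : ∀ n u, 0 < u → ψ n u ≤ ⨆ n, ψ n u := fun n u hu => le_ciSup (hbdd u hu) n
  obtain ⟨C, hC, hTC⟩ := hT _ hsup (by
    refine (lt_of_le_of_lt ?_ (weightedNorm_iSup_ne_top hb hq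
      (fun n u => ENNReal.ofReal (ψ n u)) (fun n => ?_) hψn).lt_top).ne
    · refine (weightedNorm_le_mul (k' := fun u => ⨆ n, ENNReal.ofReal (ψ n u))
        measurableSet_Ioi 1 fun u hu => ?_).trans (by simp)
      simp only [ENNReal.ofReal_one, one_mul]
      by_contra! hlt
      obtain ⟨r, hr, hr'⟩ := ENNReal.lt_iff_exists_nnreal_btwn.1 hlt
      have : ⨆ n, ψ n u ≤ r := ciSup_le fun n => by
        have h3 := (le_iSup (fun n => ENNReal.ofReal (ψ n u)) n).trans hr.le
        exact Real.toNNReal_le_iff_le_coe.1 (ENNReal.coe_le_coe.1 h3)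
      exact absurd hr' (not_lt.2 (ENNReal.coe_le_coe.2 (Real.toNNReal_le_iff_le_coe.2 this)))
    · exact (aemeasurable_restrict_of_monotoneOn measurableSet_Ioi
        (hψq n).monotone).ennreal_ofReal)
  obtain ⟨n, hn⟩ := pow_unbounded_of_one_lt C.toReal one_lt_two
  refine absurd (hTC (i n)) (not_le.2 ?_)
  refine ((ENNReal.lt_ofReal_iff_toReal_lt hC).2 hn).trans_le ?_
  refine le_trans ?_ (show T (i n) (fun u => ENNReal.ofReal (ψ n u)) ≤ _ from
    (hmono (i n) _ (fun u => ENNReal.ofReal (⨆ n, ψ n u)) 1 fun u hu => by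
      simpa using ENNReal.ofReal_le_ofReal (hle n u hu)).trans (by simp))
  by_contra! hlt
  have h4 := (hi n).trans_le (hmono (i n) _ (fun u => ENNReal.ofReal (ψ n u)) (2 ^ n * N n)
    fun u hu => by
      rw [← ENNReal.ofReal_mul (hc n).le, hψ, mul_inv_cancel_left₀ (hc n).ne'])
  refine absurd h4 (not_lt.2 ?_)
  calc _ ≤ ENNReal.ofReal (2 ^ n * N n) * ENNReal.ofReal (2 ^ n) := by gcongr
    _ = _ := by
      rw [← ENNReal.ofReal_mul (hc n).le]
      congr 1
      rw [show (4 : ℝ) = 2 * 2 by norm_num, mul_pow]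
      ring

end QuasiConcave

/-! ### Power integrals. -/

section Integrals

theorem lintegral_Ioc_zero_rpow_sub_one {p a : ℝ} (hp : 0 < p) (ha : 0 < a) :
    ∫⁻ u in Ioc 0 a, ENNReal.ofReal (u ^ (p - 1)) = ENNReal.ofReal (a ^ p / p) := by
  have hi := (intervalIntegral.intervalIntegrable_rpow' (a := 0) (b := a)
    (show -1 < p - 1 by linarith)).1
  rw [← ofReal_integral_eq_lintegral_ofReal hi
    (ae_restrict_of_forall_mem measurableSet_Ioc fun u hu => Real.rpow_nonneg hu.1.le _),
    ← intervalIntegral.integral_of_le ha.le, integral_rpow (Or.inl (by linarith))]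
  simp [Real.zero_rpow hp.ne']

theorem lintegral_Ioi_rpow_neg_sub_one {p d : ℝ} (hp : 0 < p) (hd : 0 < d) :
    ∫⁻ u in Ioi d, ENNReal.ofReal (u ^ (-p - 1)) = ENNReal.ofReal (d ^ (-p) / p) := by
  have hlt : -p - 1 < -1 := by linarith
  rw [← ofReal_integral_eq_lintegral_ofReal (integrableOn_Ioi_rpow_of_lt hlt hd)
    (ae_restrict_of_forall_mem measurableSet_Ioi
      fun u hu => Real.rpow_nonneg (hd.trans hu).le _),
    integral_Ioi_rpow_of_lt hlt hd]
  simp [neg_div_neg_eq]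

theorem lintegral_Ioc_inv {a d : ℝ} (ha : 0 < a) (hd : a ≤ d) :
    ∫⁻ u in Ioc a d, ENNReal.ofReal u⁻¹ = ENNReal.ofReal (Real.log (d / a)) := by
  have hi : IntegrableOn (fun u : ℝ => u⁻¹) (Ioc a d) :=
    (intervalIntegrable_inv_iff.2 (Or.inr
      (notMem_uIcc_of_lt ha (ha.trans_le hd)))).1
  rw [← ofReal_integral_eq_lintegral_ofReal hi
    (ae_restrict_of_forall_mem measurableSet_Ioc fun u hu => (inv_pos.2 (ha.trans hu.1)).le),
    ← intervalIntegral.integral_of_le hd, integral_inv_of_pos ha (ha.trans_le hd)]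

end Integrals

/-! ### Slowly varying weights and plateau functions. -/

section SlowlyVarying

variable {b : ℝ → ℝ}

/-- Potter-type bound. The decreasing majorant of `t ^ (-ε) * b t` controls growth, the increasing
one of `t ^ ε * b t` controls decay. -/
theorem SlowlyVarying.exists_le_rpow_mul (hb : SlowlyVarying b) {ε : ℝ} (hε : 0 < ε) :
    ∃ C : ℝ, 0 < C ∧ ∀ s u : ℝ, 0 < s → s ≤ u →
      b u ≤ C * (u / s) ^ ε * b s ∧ b s ≤ C * (u / s) ^ ε * b u := by
  obtain ⟨g, -, hg, c, hc, C, hC, h⟩ := hb.exists_monotone ε hε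
  obtain ⟨g', -, hg', c', hc', C', hC', h'⟩ := hb.exists_antitone ε hε
  refine ⟨C / c + C' / c', by positivity, fun s u hs hsu => ?_⟩
  have hu := hs.trans_le hsu
  have hbs := hb.pos s hs
  have hbu := hb.pos u hu
  have hsε := Real.rpow_pos_of_pos hs ε
  have huε := Real.rpow_pos_of_pos hu ε
  have hr : 0 < (u / s) ^ ε := Real.rpow_pos_of_pos (by positivity) _
  constructor
  · have h1 : u ^ (-ε) * b u ≤ C' / c' * (s ^ (-ε) * b s) := by
      calc _ ≤ C' * g' u := (h' u hu).2
        _ ≤ C' * g' s := by gcongr; exact hg' hs hu hsu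
        _ = C' / c' * (c' * g' s) := by field_simp
        _ ≤ _ := mul_le_mul_of_nonneg_left (h' s hs).1 (by positivity)
    rw [Real.rpow_neg hu.le, Real.rpow_neg hs.le, inv_mul_eq_div, div_le_iff₀ huε] at h1
    have h2 : b u ≤ C' / c' * (u / s) ^ ε * b s := by
      rw [Real.div_rpow hu.le hs.le]
      calc _ ≤ _ := h1
        _ = _ := by ring
    refine h2.trans ?_
    have : C' / c' ≤ C / c + C' / c' := le_add_of_nonneg_left (by positivity)
    gcongr
  · have h1 : s ^ ε * b s ≤ C / c * (u ^ ε * b u) := by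
      calc _ ≤ C * g s := (h s hs).2
        _ ≤ C * g u := by gcongr; exact hg hs hu hsu
        _ = C / c * (c * g u) := by field_simp
        _ ≤ _ := mul_le_mul_of_nonneg_left (h u hu).1 (by positivity)
    have h2 : b s ≤ C / c * (u / s) ^ ε * b u := by
      rw [Real.div_rpow hu.le hs.le]
      rw [← le_div_iff₀' hsε] at h1
      calc _ ≤ _ := h1
        _ = _ := by ring
    refine h2.trans ?_
    have : C / c ≤ C / c + C' / c' := le_add_of_nonneg_right (by positivity)
    gcongr

/-- The block `min 1 (u / s)`, normalised at `s`, decays like a power on both sides of `s`: the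
exponents `1 - θ` and `θ` are positive, and slow variation costs only `δ`, at most half of either.
-/
theorem SlowlyVarying.exists_min_mul_le (hb : SlowlyVarying b) {θ : ℝ} (hθ₀ : 0 < θ)
    (hθ₁ : θ < 1) :
    ∃ δ : ℝ, 0 < δ ∧ ∃ D : ℝ, 0 < D ∧ ∀ s u : ℝ, 0 < s → 0 < u →
      (u ≤ s → u ^ (-θ) * b u * (min 1 (u / s) * (s ^ θ / b s)) ≤ D * (u / s) ^ δ) ∧
      (s ≤ u → u ^ (-θ) * b u * (min 1 (u / s) * (s ^ θ / b s)) ≤ D * (s / u) ^ δ) := by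
  set δ := min θ (1 - θ) / 2 with hδdef
  have hδ : 0 < δ := half_pos (lt_min hθ₀ (by linarith))
  have hδ₀ : δ ≤ θ - δ := by have := min_le_left θ (1 - θ); linarith
  have hδ₁ : δ ≤ 1 - θ - δ := by have := min_le_right θ (1 - θ); linarith
  obtain ⟨C, hC, h⟩ := hb.exists_le_rpow_mul hδ
  refine ⟨δ, hδ, C, hC, fun s u hs hu => ⟨fun hus => ?_, fun hsu => ?_⟩⟩
  · have hbs := hb.pos s hs
    have hr : 0 < u / s := by positivity
    have hr1 : u / s ≤ 1 := (div_le_one hs).2 hus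
    have h1 : b u / b s ≤ C * (u / s) ^ (-δ) := by
      rw [div_le_iff₀ hbs, Real.rpow_neg hr.le, ← Real.inv_rpow hr.le, inv_div]
      exact (h u s hu hus).2
    calc _ = (u / s) * (u / s) ^ (-θ) * (b u / b s) := by
          rw [min_eq_right hr1, Real.div_rpow hu.le hs.le, Real.rpow_neg hs.le θ]
          have := (Real.rpow_pos_of_pos hs θ).ne'
          field_simp
      _ ≤ (u / s) * (u / s) ^ (-θ) * (C * (u / s) ^ (-δ)) := by gcongr
      _ = C * (u / s) ^ (1 - θ - δ) := by
          rw [show 1 - θ - δ = 1 + -θ + -δ by ring, Real.rpow_add hr, Real.rpow_add hr,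
            Real.rpow_one]
          ring
      _ ≤ _ := mul_le_mul_of_nonneg_left
          (Real.rpow_le_rpow_of_exponent_ge hr hr1 hδ₁) hC.le
  · have hbs := hb.pos s hs
    have hr : 0 < s / u := by positivity
    have hr1 : s / u ≤ 1 := (div_le_one hu).2 hsu
    have h1 : b u / b s ≤ C * (s / u) ^ (-δ) := by
      rw [div_le_iff₀ hbs, Real.rpow_neg hr.le, ← Real.inv_rpow hr.le, inv_div]
      exact (h s u hs hsu).1
    calc _ = (s / u) ^ θ * (b u / b s) := by
          rw [min_eq_left ((one_le_div hs).2 hsu), Real.div_rpow hs.le hu.le,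
            Real.rpow_neg hu.le θ]
          ring
      _ ≤ (s / u) ^ θ * (C * (s / u) ^ (-δ)) := by gcongr
      _ = C * (s / u) ^ (θ - δ) := by
          rw [sub_eq_add_neg, Real.rpow_add hr]
          ring
      _ ≤ _ := mul_le_mul_of_nonneg_left
          (Real.rpow_le_rpow_of_exponent_ge hr hr1 hδ₀) hC.le

/-- The `L^q` norm of `u ^ (-1/q)` on `(a, d)` is `log (d / a) ^ (1/q)`; at `q = ∞` the exponent `1
/ q.toReal` is `0` and the factor is `1`. -/
theorem le_weightedNorm_Ioo {θ : ℝ} {q : ℝ≥0∞} (hq : q ≠ 0) {φ : ℝ → ℝ} {a d m : ℝ}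
    (ha : 0 < a) (hd : a < d) (hm : 0 ≤ m)
    (h : ∀ u ∈ Ioo a d, m ≤ u ^ (-θ) * b u * φ u) (hφ : ∀ u ∈ Ioo a d, 0 ≤ φ u) :
    ENNReal.ofReal (m * Real.log (d / a) ^ (1 / q.toReal)) ≤
      weightedNorm θ q b (fun u => ENNReal.ofReal (φ u)) (Ioo a d) := by
  have hL : 0 < Real.log (d / a) := Real.log_pos ((one_lt_div ha).2 hd)
  have key : ∀ u ∈ Ioo a d, ENNReal.ofReal (u ^ (-(1 / q.toReal)) * m) ≤
      ENNReal.ofReal (u ^ (-θ - 1 / q.toReal) * b u) * ENNReal.ofReal (φ u) := fun u hu => by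
    have hu0 : 0 < u := ha.trans hu.1
    rw [← ENNReal.ofReal_mul' (hφ u hu)]
    refine ENNReal.ofReal_le_ofReal ?_
    calc _ ≤ u ^ (-(1 / q.toReal)) * (u ^ (-θ) * b u * φ u) :=
          mul_le_mul_of_nonneg_left (h u hu) (Real.rpow_nonneg hu0.le _)
      _ = _ := by rw [sub_eq_add_neg, Real.rpow_add hu0]; ring
  have hmono : eLpNorm (fun u => ENNReal.ofReal (u ^ (-(1 / q.toReal)) * m)) q
      (volume.restrict (Ioo a d)) ≤
      weightedNorm θ q b (fun u => ENNReal.ofReal (φ u)) (Ioo a d) :=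
    eLpNorm_mono_enorm_ae (ae_restrict_of_forall_mem measurableSet_Ioo fun u hu => by
      simpa only [enorm_eq_self] using key u hu)
  refine le_trans (le_of_eq ?_) hmono
  rcases eq_or_ne q ∞ with rfl | hqt
  · have hμ : volume.restrict (Ioo a d) ≠ 0 := by simp [hd]
    simp [eLpNormEssSup_const _ hμ]
  · have hp : 0 < q.toReal := ENNReal.toReal_pos hq hqt
    rw [eLpNorm_eq_lintegral_rpow_enorm_toReal hq hqt]
    have : ∫⁻ u in Ioo a d, ‖ENNReal.ofReal (u ^ (-(1 / q.toReal)) * m)‖ₑ ^ q.toReal =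
        ENNReal.ofReal (m ^ q.toReal) * ∫⁻ u in Ioo a d, ENNReal.ofReal u⁻¹ := by
      rw [← lintegral_const_mul' _ _ ENNReal.ofReal_ne_top]
      refine setLIntegral_congr_fun measurableSet_Ioo fun u hu => ?_
      have hu0 : 0 < u := ha.trans hu.1
      have := Real.rpow_nonneg hu0.le (-(1 / q.toReal))
      simp only [enorm_eq_self]
      rw [ENNReal.ofReal_rpow_of_nonneg (by positivity) hp.le,
        ← ENNReal.ofReal_mul (by positivity), Real.mul_rpow this hm, ← Real.rpow_mul hu0.le,
        show -(1 / q.toReal) * q.toReal = -1 by field_simp, Real.rpow_neg_one, mul_comm]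
    rw [this, setLIntegral_congr Ioo_ae_eq_Ioc, lintegral_Ioc_inv ha hd.le,
      ← ENNReal.ofReal_mul (by positivity),
      ENNReal.ofReal_rpow_of_nonneg (by positivity) (by positivity),
      Real.mul_rpow (by positivity) hL.le, ← Real.rpow_mul hm, mul_one_div_cancel hp.ne',
      Real.rpow_one]

theorem weightedNorm_le_of_plateau {θ : ℝ} {q : ℝ≥0∞} (hq : q ≠ 0) {D δ : ℝ} (hD : 0 < D)
    (hδ : 0 < δ) :
    ∃ D' : ℝ, 0 < D' ∧ ∀ φ : ℝ → ℝ, (∀ u, 0 < u → 0 ≤ φ u) → ∀ a d : ℝ, 0 < a → a < d →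
      1 ≤ Real.log (d / a) →
      (∀ u ∈ Ioc 0 a, u ^ (-θ) * b u * φ u ≤ D * (u / a) ^ δ) →
      (∀ u ∈ Ioc a d, u ^ (-θ) * b u * φ u ≤ D) →
      (∀ u ∈ Ioi d, u ^ (-θ) * b u * φ u ≤ D * (d / u) ^ δ) →
      weightedNorm θ q b (fun u => ENNReal.ofReal (φ u)) (Ioi 0) ≤
        ENNReal.ofReal (D' * Real.log (d / a) ^ (1 / q.toReal)) := by
  have heq : ∀ φ : ℝ → ℝ, (∀ u, 0 < u → 0 ≤ φ u) → ∀ u : ℝ, 0 < u →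
      ENNReal.ofReal (u ^ (-θ - 1 / q.toReal) * b u) * ENNReal.ofReal (φ u) =
      ENNReal.ofReal (u ^ (-(1 / q.toReal)) * (u ^ (-θ) * b u * φ u)) := fun φ hφ u hu => by
    rw [← ENNReal.ofReal_mul' (hφ u hu), sub_eq_add_neg, Real.rpow_add hu]
    congr 1
    ring
  rcases eq_or_ne q ∞ with rfl | hqt
  · refine ⟨D, hD, fun φ hφ a d ha hd hL h1 h2 h3 => ?_⟩
    rw [weightedNorm, eLpNorm_exponent_top]
    refine eLpNormEssSup_le_of_ae_enorm_bound
      (ae_restrict_of_forall_mem measurableSet_Ioi fun u hu => ?_)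
    have hu0 : 0 < u := hu
    have hd0 := ha.trans hd
    rw [enorm_eq_self, heq φ hφ u hu]
    refine ENNReal.ofReal_le_ofReal ?_
    simp only [ENNReal.toReal_top, div_zero, neg_zero, Real.rpow_zero, one_mul, mul_one]
    rcases le_or_gt u a with hua | hua
    · refine (h1 u ⟨hu, hua⟩).trans (mul_le_of_le_one_right hD.le ?_)
      exact Real.rpow_le_one (by positivity) ((div_le_one ha).2 hua) hδ.le
    rcases le_or_gt u d with hud | hud
    · exact h2 u ⟨hua, hud⟩
    · refine (h3 u hud).trans (mul_le_of_le_one_right hD.le ?_)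
      exact Real.rpow_le_one (by positivity) ((div_le_one hu0).2 hud.le) hδ.le
  · set p := q.toReal with hpdef
    have hp : 0 < p := ENNReal.toReal_pos hq hqt
    -- Each tail contributes `1 / (δ * p)`, the plateau contributes `L`; since `1 ≤ L`, the tails
    -- are absorbed into the multiple of `L`.
    refine ⟨D * (1 + 2 / (δ * p)) ^ (1 / p), by positivity, fun φ hφ a d ha hd hL h1 h2 h3 => ?_⟩
    have hd0 := ha.trans hd
    set L := Real.log (d / a)
    have hL0 : 0 < L := one_pos.trans_le hL
    have hδp : 0 < δ * p := by positivity
    set F : ℝ → ℝ≥0∞ := fun u =>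
      (ENNReal.ofReal (u ^ (-θ - 1 / p) * b u) * ENNReal.ofReal (φ u)) ^ p with hF
    have hbound : ∀ u : ℝ, 0 < u → ∀ y : ℝ, 0 ≤ y → u ^ (-θ) * b u * φ u ≤ D * y →
        F u ≤ ENNReal.ofReal (D ^ p) * ENNReal.ofReal (u⁻¹ * y ^ p) := fun u hu y hy hle => by
      have hun := Real.rpow_nonneg hu.le (-(1 / p))
      simp only [hF]
      rw [heq φ hφ u hu, ← ENNReal.ofReal_mul (by positivity)]
      calc _ ≤ (ENNReal.ofReal (u ^ (-(1 / p)) * (D * y))) ^ p := by gcongr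
        _ = _ := by
          rw [ENNReal.ofReal_rpow_of_nonneg (by positivity) hp.le,
            Real.mul_rpow hun (by positivity), Real.mul_rpow hD.le hy, ← Real.rpow_mul hu.le,
            show -(1 / p) * p = -1 by field_simp, Real.rpow_neg_one]
          congr 1
          ring
    have i1 : ∫⁻ u in Ioc 0 a, F u ≤ ENNReal.ofReal (D ^ p) * ENNReal.ofReal (1 / (δ * p)) := by
      calc _ ≤ ∫⁻ u in Ioc 0 a, ENNReal.ofReal (D ^ p * a ^ (-(δ * p))) *
            ENNReal.ofReal (u ^ (δ * p - 1)) := by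
            refine setLIntegral_mono' measurableSet_Ioc fun u hu => ?_
            have hu0 : 0 < u := hu.1
            refine (hbound u hu0 _ (by positivity) (h1 u hu)).trans (le_of_eq ?_)
            rw [← ENNReal.ofReal_mul (by positivity), ← ENNReal.ofReal_mul (by positivity),
              ← Real.rpow_mul (by positivity), Real.div_rpow hu0.le ha.le, Real.rpow_neg ha.le,
              Real.rpow_sub_one hu0.ne']
            congr 1
            ring
        _ = _ := by
            rw [lintegral_const_mul' _ _ ENNReal.ofReal_ne_top,
              lintegral_Ioc_zero_rpow_sub_one hδp ha, ← ENNReal.ofReal_mul (by positivity),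
              ← ENNReal.ofReal_mul (by positivity), Real.rpow_neg ha.le]
            have := (Real.rpow_pos_of_pos ha (δ * p)).ne'
            congr 1
            field_simp
    have i2 : ∫⁻ u in Ioc a d, F u ≤ ENNReal.ofReal (D ^ p) * ENNReal.ofReal L := by
      rw [← lintegral_Ioc_inv ha hd.le, ← lintegral_const_mul' _ _ ENNReal.ofReal_ne_top]
      refine setLIntegral_mono' measurableSet_Ioc fun u hu => ?_
      simpa using hbound u (ha.trans hu.1) 1 zero_le_one (by simpa using h2 u hu)
    have i3 : ∫⁻ u in Ioi d, F u ≤ ENNReal.ofReal (D ^ p) * ENNReal.ofReal (1 / (δ * p)) := by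
      calc _ ≤ ∫⁻ u in Ioi d, ENNReal.ofReal (D ^ p * d ^ (δ * p)) *
            ENNReal.ofReal (u ^ (-(δ * p) - 1)) := by
            refine setLIntegral_mono' measurableSet_Ioi fun u hu => ?_
            have hu0 : 0 < u := hd0.trans hu
            refine (hbound u hu0 _ (by positivity) (h3 u hu)).trans (le_of_eq ?_)
            rw [← ENNReal.ofReal_mul (by positivity), ← ENNReal.ofReal_mul (by positivity),
              ← Real.rpow_mul (by positivity), Real.div_rpow hd0.le hu0.le,
              Real.rpow_sub_one hu0.ne', Real.rpow_neg hu0.le]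
            congr 1
            ring
        _ = _ := by
            rw [lintegral_const_mul' _ _ ENNReal.ofReal_ne_top,
              lintegral_Ioi_rpow_neg_sub_one hδp hd0, ← ENNReal.ofReal_mul (by positivity),
              ← ENNReal.ofReal_mul (by positivity), Real.rpow_neg hd0.le]
            have := (Real.rpow_pos_of_pos hd0 (δ * p)).ne'
            congr 1
            field_simp
    have hsub : Ioi 0 ⊆ Ioc 0 a ∪ (Ioc a d ∪ Ioi d) := fun u hu => by
      rcases le_or_gt u a with hua | hua
      · exact Or.inl ⟨hu, hua⟩
      rcases le_or_gt u d with hud | hud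
      · exact Or.inr (Or.inl ⟨hua, hud⟩)
      · exact Or.inr (Or.inr hud)
    have hF_le : ∫⁻ u in Ioi 0, F u ≤ ENNReal.ofReal (D ^ p * ((1 + 2 / (δ * p)) * L)) := by
      calc ∫⁻ u in Ioi 0, F u
          ≤ ∫⁻ u in Ioc 0 a ∪ (Ioc a d ∪ Ioi d), F u := lintegral_mono_set hsub
        _ ≤ (∫⁻ u in Ioc 0 a, F u) + ((∫⁻ u in Ioc a d, F u) + ∫⁻ u in Ioi d, F u) :=
            (lintegral_union_le _ _ _).trans (add_le_add_right (lintegral_union_le _ _ _) _)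
        _ ≤ ENNReal.ofReal (D ^ p) * ENNReal.ofReal (1 / (δ * p)) +
            (ENNReal.ofReal (D ^ p) * ENNReal.ofReal L +
              ENNReal.ofReal (D ^ p) * ENNReal.ofReal (1 / (δ * p))) :=
            add_le_add i1 (add_le_add i2 i3)
        _ = ENNReal.ofReal (D ^ p * (L + 2 / (δ * p))) := by
            rw [← mul_add, ← mul_add, ← ENNReal.ofReal_add (by positivity) (by positivity),
              ← ENNReal.ofReal_add (by positivity) (by positivity),
              ← ENNReal.ofReal_mul (by positivity)]
            congr 1
            ring
        _ ≤ ENNReal.ofReal (D ^ p * ((1 + 2 / (δ * p)) * L)) := by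
            gcongr
            rw [add_mul, one_mul]
            gcongr
            exact le_mul_of_one_le_right (by positivity) hL
    calc _ = (∫⁻ u in Ioi 0, F u) ^ (1 / p) := eLpNorm_eq_lintegral_rpow_enorm_toReal hq hqt
      _ ≤ (ENNReal.ofReal (D ^ p * ((1 + 2 / (δ * p)) * L))) ^ (1 / p) := by gcongr
      _ = _ := by
          rw [ENNReal.ofReal_rpow_of_nonneg (by positivity) (by positivity),
            Real.mul_rpow (by positivity) (by positivity), ← Real.rpow_mul hD.le,
            mul_one_div_cancel hp.ne', Real.rpow_one, Real.mul_rpow (by positivity) hL0.le,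
            mul_assoc]

/-- Quasi-concave functions that dominate `u ^ θ / b u` on an interval and have the least possible
weighted norm. -/
theorem SlowlyVarying.exists_quasiConcave_plateau (hb : SlowlyVarying b) {θ : ℝ} (hθ₀ : 0 < θ)
    (hθ₁ : θ < 1) {q : ℝ≥0∞} (hq : q ≠ 0) :
    ∃ D : ℝ, 0 < D ∧ ∀ a d : ℝ, 0 < a → a < d → 1 ≤ Real.log (d / a) →
      ∃ φ, QuasiConcave φ ∧ (∀ u ∈ Ioo a d, u ^ θ / b u ≤ φ u) ∧
        weightedNorm θ q b (fun u => ENNReal.ofReal (φ u)) (Ioi 0) ≤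
          ENNReal.ofReal (D * Real.log (d / a) ^ (1 / q.toReal)) := by
  obtain ⟨δ, hδ, D, hD, h⟩ := hb.exists_min_mul_le hθ₀ hθ₁
  obtain ⟨D', hD', h'⟩ := weightedNorm_le_of_plateau (θ := θ) (b := b) hq hD hδ
  refine ⟨D', hD', fun a d ha hd hL => ?_⟩
  have hd0 := ha.trans hd
  -- The plateau is the supremum of the normalised blocks over `s` in `[a, d]`. The block at `s = u`
  -- gives the lower bound; outside `[a, d]` the nearer endpoint governs the decay.
  set ψ : Icc a d → ℝ → ℝ := fun s u => (s : ℝ) ^ θ / b s * min 1 (u / s) with hψ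
  have hs0 : ∀ s : Icc a d, 0 < (s : ℝ) := fun s => ha.trans_le s.2.1
  have : Nonempty (Icc a d) := ⟨⟨a, le_rfl, hd.le⟩⟩
  have hψq : ∀ s, QuasiConcave (ψ s) := fun s =>
    (quasiConcave_min_one_div (hs0 s)).const_mul
      (div_pos (Real.rpow_pos_of_pos (hs0 s) θ) (hb.pos s (hs0 s)))
  have hW : ∀ u : ℝ, 0 < u → 0 < u ^ (-θ) * b u := fun u hu =>
    mul_pos (Real.rpow_pos_of_pos hu _) (hb.pos u hu)
  have hle : ∀ (s : Icc a d) (u : ℝ), 0 < u → u ^ (-θ) * b u * ψ s u ≤ D := fun s u hu => by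
    have hs := hs0 s
    rw [hψ]
    simp only
    rw [mul_comm (_ / _)]
    rcases le_total u s with hus | hus
    · refine ((h s u hs hu).1 hus).trans (mul_le_of_le_one_right hD.le ?_)
      exact Real.rpow_le_one (by positivity) ((div_le_one hs).2 hus) hδ.le
    · refine ((h s u hs hu).2 hus).trans (mul_le_of_le_one_right hD.le ?_)
      exact Real.rpow_le_one (by positivity) ((div_le_one hu).2 hus) hδ.le
  have hbdd : ∀ u : ℝ, 0 < u → BddAbove (range fun s => ψ s u) := fun u hu => by
    refine ⟨D / (u ^ (-θ) * b u), ?_⟩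
    rintro _ ⟨s, rfl⟩
    exact (le_div_iff₀' (hW u hu)).2 (hle s u hu)
  have hsup := QuasiConcave.iSup hψq hbdd
  have hsup_le : ∀ u : ℝ, 0 < u → ∀ y : ℝ, (∀ s, u ^ (-θ) * b u * ψ s u ≤ y) →
      u ^ (-θ) * b u * ⨆ s, ψ s u ≤ y := fun u hu y hy => by
    rw [Real.mul_iSup_of_nonneg (hW u hu).le]
    exact ciSup_le hy
  refine ⟨fun u => ⨆ s, ψ s u, hsup, fun u hu => ?_,
    h' _ (fun u hu => (hsup.pos u hu).le) a d ha hd hL (fun u hu => ?_) (fun u hu => ?_)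
      (fun u hu => ?_)⟩
  · have hu0 : 0 < u := ha.trans hu.1
    refine le_trans (le_of_eq ?_) (le_ciSup (hbdd u hu0) ⟨u, hu.1.le, hu.2.le⟩)
    simp [hψ, div_self hu0.ne']
  · have hu0 : 0 < u := hu.1
    refine hsup_le u hu0 _ fun s => ?_
    have hs := hs0 s
    have := (h s u hs hu0).1 (hu.2.trans s.2.1)
    simp only [hψ]
    rw [mul_comm (_ / _)]
    refine this.trans ?_
    gcongr
    exact s.2.1
  · have hu0 : 0 < u := ha.trans hu.1
    exact hsup_le u hu0 _ fun s => hle s u hu0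
  · have hu0 : 0 < u := hd0.trans hu
    refine hsup_le u hu0 _ fun s => ?_
    have hs := hs0 s
    have := (h s u hs hu0).2 (s.2.2.trans (le_of_lt hu))
    simp only [hψ]
    rw [mul_comm (_ / _)]
    refine this.trans ?_
    gcongr
    exact s.2.2

end SlowlyVarying

/-! ### The quotient `b₀ / b₁` and the contradiction. -/

section Quotient

variable {b₀ b₁ : ℝ → ℝ}

theorem SlowlyVarying.exists_div_le_rpow_mul (hb₀ : SlowlyVarying b₀) (hb₁ : SlowlyVarying b₁)
    {ε : ℝ} (hε : 0 < ε) :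
    ∃ C : ℝ, 0 < C ∧ ∀ s u : ℝ, 0 < s → s ≤ u →
      b₀ u / b₁ u ≤ C * (u / s) ^ ε * (b₀ s / b₁ s) ∧
      b₀ s / b₁ s ≤ C * (u / s) ^ ε * (b₀ u / b₁ u) := by
  obtain ⟨C₀, hC₀, h₀⟩ := hb₀.exists_le_rpow_mul (half_pos hε)
  obtain ⟨C₁, hC₁, h₁⟩ := hb₁.exists_le_rpow_mul (half_pos hε)
  refine ⟨C₀ * C₁, by positivity, fun s u hs hsu => ?_⟩
  have hu := hs.trans_le hsu
  have p₀s := hb₀.pos s hs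
  have p₁s := hb₁.pos s hs
  have p₀u := hb₀.pos u hu
  have p₁u := hb₁.pos u hu
  have hr : (u / s) ^ ε = (u / s) ^ (ε / 2) * (u / s) ^ (ε / 2) := by
    rw [← Real.rpow_add (by positivity), add_halves]
  obtain ⟨h₀u, h₀s⟩ := h₀ s u hs hsu
  obtain ⟨h₁u, h₁s⟩ := h₁ s u hs hsu
  rw [hr]
  constructor
  · rw [div_le_iff₀ p₁u]
    calc b₀ u ≤ C₀ * (u / s) ^ (ε / 2) * b₀ s / b₁ s * b₁ s := by
          rw [div_mul_cancel₀ _ p₁s.ne']; exact h₀u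
      _ ≤ C₀ * (u / s) ^ (ε / 2) * b₀ s / b₁ s * (C₁ * (u / s) ^ (ε / 2) * b₁ u) := by gcongr
      _ = _ := by ring
  · rw [div_le_iff₀ p₁s]
    calc b₀ s ≤ C₀ * (u / s) ^ (ε / 2) * b₀ u / b₁ u * b₁ u := by
          rw [div_mul_cancel₀ _ p₁u.ne']; exact h₀s
      _ ≤ C₀ * (u / s) ^ (ε / 2) * b₀ u / b₁ u * (C₁ * (u / s) ^ (ε / 2) * b₁ s) := by gcongr
      _ = _ := by ring

theorem SlowlyVarying.exists_quasiConcave_compare (hb₀ : SlowlyVarying b₀)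
    (hb₁ : SlowlyVarying b₁) {θ : ℝ} (hθ₀ : 0 < θ) (hθ₁ : θ < 1) {q₀ q₁ : ℝ≥0∞} (hq₀ : q₀ ≠ 0)
    (hq₁ : q₁ ≠ 0) :
    ∃ D : ℝ, 0 < D ∧ ∀ a L : ℝ, 0 < a → 1 ≤ L →
      ∃ φ, QuasiConcave φ ∧
        weightedNorm θ q₀ b₀ (fun u => ENNReal.ofReal (φ u)) (Ioi 0) ≤
          ENNReal.ofReal (D * L ^ (1 / q₀.toReal)) ∧
        ∀ m : ℝ, 0 ≤ m → (∀ u ∈ Ioo a (a * Real.exp L), m ≤ b₁ u / b₀ u) →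
          ENNReal.ofReal (m * L ^ (1 / q₁.toReal)) ≤
            weightedNorm θ q₁ b₁ (fun u => ENNReal.ofReal (φ u)) (Ioo a (a * Real.exp L)) := by
  obtain ⟨D, hD, h⟩ := hb₀.exists_quasiConcave_plateau hθ₀ hθ₁ hq₀
  refine ⟨D, hD, fun a L ha hL => ?_⟩
  have hlog : Real.log (a * Real.exp L / a) = L := by
    rw [mul_div_cancel_left₀ _ ha.ne', Real.log_exp]
  have hd : a < a * Real.exp L :=
    lt_mul_of_one_lt_right ha (Real.one_lt_exp_iff.2 (one_pos.trans_le hL))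
  obtain ⟨φ, hφ, hle, hN⟩ := h a _ ha hd (hL.trans_eq hlog.symm)
  rw [hlog] at hN
  refine ⟨φ, hφ, hN, fun m hm hmu => ?_⟩
  have := le_weightedNorm_Ioo (θ := θ) (b := b₁) (φ := φ) hq₁ ha hd hm (fun u hu => ?_)
    (fun u hu => (hφ.pos u (ha.trans hu.1)).le)
  · rwa [hlog] at this
  · have hu0 : 0 < u := ha.trans hu.1
    have h₁ := hb₁.pos u hu0
    calc m ≤ b₁ u / b₀ u := hmu u hu
      _ = u ^ (-θ) * b₁ u * (u ^ θ / b₀ u) := by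
        rw [Real.rpow_neg hu0.le]
        have := (Real.rpow_pos_of_pos hu0 θ).ne'
        field_simp
      _ ≤ _ := by gcongr; exact hle u hu

/-- For one fixed large `L` the hypothesis makes `b₀ / b₁` at least quadruple from `a` to `a e^L`,
hence grow like `4 ^ n` along `e^(L n)`, whereas slow variation allows only `C * 2 ^ n`. -/
theorem not_rpow_growth (hb₀ : SlowlyVarying b₀) (hb₁ : SlowlyVarying b₁) {α B : ℝ} (hα : 0 < α)
    (h : ∀ a L : ℝ, 0 < a → 1 ≤ L →
      b₀ a / b₁ a * L ^ α ≤ B * (b₀ (a * Real.exp L) / b₁ (a * Real.exp L))) : False := by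
  set ρ : ℝ → ℝ := fun s => b₀ s / b₁ s with hρ
  have hρpos : ∀ s, 0 < s → 0 < ρ s := fun s hs => div_pos (hb₀.pos s hs) (hb₁.pos s hs)
  obtain ⟨L, hL1, hL⟩ : ∃ L : ℝ, 1 ≤ L ∧ 4 * |B| + 4 ≤ L ^ α :=
    ((Filter.eventually_ge_atTop 1).and
      ((tendsto_rpow_atTop hα).eventually_ge_atTop _)).exists
  have hB : 0 < |B| + 1 := by positivity
  have hstep : ∀ a, 0 < a → 4 * ρ a ≤ ρ (a * Real.exp L) := fun a ha => by
    have hρa := hρpos a ha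
    have hρd := hρpos (a * Real.exp L) (by positivity)
    have h1 : ρ a * (4 * (|B| + 1)) ≤ (|B| + 1) * ρ (a * Real.exp L) :=
      calc _ ≤ ρ a * L ^ α := by gcongr; linarith
        _ ≤ B * ρ (a * Real.exp L) := h a L ha hL1
        _ ≤ _ := by gcongr; linarith [le_abs_self B]
    refine le_of_mul_le_mul_left ?_ hB
    linarith
  have hiter : ∀ n : ℕ, 4 ^ n * ρ 1 ≤ ρ (Real.exp L ^ n) := by
    intro n
    induction n with
    | zero => simp
    | succ n ih =>
      have := hstep (Real.exp L ^ n) (by positivity)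
      rw [pow_succ (Real.exp L), pow_succ]
      linarith
  have hL0 : 0 < L := one_pos.trans_le hL1
  -- This exponent makes `(e^(L n)) ^ ε` equal to `2 ^ n`.
  have hε : 0 < Real.log 2 / L := div_pos (Real.log_pos one_lt_two) hL0
  obtain ⟨C, hC, hCle⟩ := hb₀.exists_div_le_rpow_mul hb₁ hε
  obtain ⟨n, hn⟩ := pow_unbounded_of_one_lt C one_lt_two
  have h1 := (hCle 1 (Real.exp L ^ n) one_pos (one_le_pow₀ (Real.one_le_exp hL0.le))).1
  have h2 : (Real.exp L ^ n / 1) ^ (Real.log 2 / L) = 2 ^ n := by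
    rw [div_one, ← Real.exp_nat_mul, ← Real.exp_mul, mul_assoc, mul_div_cancel₀ _ hL0.ne',
      Real.exp_nat_mul, Real.exp_log two_pos]
  rw [h2] at h1
  have h3 := (hiter n).trans h1
  have h4 := le_of_mul_le_mul_right h3 (hρpos 1 one_pos)
  rw [show (4 : ℝ) = 2 * 2 by norm_num, mul_pow] at h4
  exact absurd (le_of_mul_le_mul_right h4 (by positivity)) (not_le.2 hn)

theorem false_of_uniform_bounds (hb₀ : SlowlyVarying b₀) (hb₁ : SlowlyVarying b₁) {θ : ℝ}
    (hθ₀ : 0 < θ) (hθ₁ : θ < 1) {q₀ q₁ : ℝ≥0∞} (hq₀ : q₀ ≠ 0) (hq₁ : q₁ ≠ 0) (hq : q₀ ≠ q₁)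
    {w : ℝ → ℝ} (hw : ∀ t : ℝ, 0 < t → 0 < w t) {C₀ C₁ : ℝ} (hC₀ : 0 < C₀) (hC₁ : 0 < C₁)
    (htail : ∀ φ, QuasiConcave φ → ∀ N : ℝ, 0 < N →
      weightedNorm θ q₀ b₀ (fun u => ENNReal.ofReal (φ u)) (Ioi 0) ≤ ENNReal.ofReal N →
      ∀ t : ℝ, 0 < t → ENNReal.ofReal (w t) *
        weightedNorm θ q₁ b₁ (fun u => ENNReal.ofReal (φ u)) (Ioi t) ≤ ENNReal.ofReal (C₀ * N))
    (hhead : ∀ φ, QuasiConcave φ → ∀ N : ℝ, 0 < N →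
      weightedNorm θ q₁ b₁ (fun u => ENNReal.ofReal (φ u)) (Ioi 0) ≤ ENNReal.ofReal N →
      ∀ t : ℝ, 0 < t → ENNReal.ofReal (w t)⁻¹ *
        weightedNorm θ q₀ b₀ (fun u => ENNReal.ofReal (φ u)) (Ioo 0 t) ≤
          ENNReal.ofReal (C₁ * N)) : False := by
  set ρ : ℝ → ℝ := fun s => b₀ s / b₁ s with hρ
  have hρpos : ∀ s, 0 < s → 0 < ρ s := fun s hs => div_pos (hb₀.pos s hs) (hb₁.pos s hs)
  have hρinv : ∀ s, b₁ s / b₀ s = (ρ s)⁻¹ := fun s => (inv_div _ _).symm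
  obtain ⟨D₀, hD₀, hφ₀⟩ := hb₀.exists_quasiConcave_compare hb₁ hθ₀ hθ₁ hq₀ hq₁
  obtain ⟨D₁, hD₁, hφ₁⟩ := hb₁.exists_quasiConcave_compare hb₀ hθ₀ hθ₁ hq₁ hq₀
  have tail : ∀ a L t m : ℝ, 0 < t → t ≤ a → 1 ≤ L → 0 ≤ m →
      (∀ u ∈ Ioo a (a * Real.exp L), m ≤ (ρ u)⁻¹) →
      w t * (m * L ^ (1 / q₁.toReal)) ≤ C₀ * (D₀ * L ^ (1 / q₀.toReal)) := by
    intro a L t m ht hta hL hm hmu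
    obtain ⟨φ, hφ, hN, hlow⟩ := hφ₀ a L (ht.trans_le hta) hL
    have hwt := hw t ht
    have hL0 : 0 < L := one_pos.trans_le hL
    have h1 := htail φ hφ _ (by positivity) hN t ht
    have h2 := (hlow m hm fun u hu => (hmu u hu).trans_eq (hρinv u).symm).trans
      (weightedNorm_mono_set (T := Ioi t) _ fun u hu => hta.trans_lt hu.1)
    have h3 := (mul_le_mul_right h2 (ENNReal.ofReal (w t))).trans h1
    rw [← ENNReal.ofReal_mul hwt.le] at h3
    exact (ENNReal.ofReal_le_ofReal_iff (by positivity)).1 h3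
  have head : ∀ a L t m : ℝ, 0 < a → a * Real.exp L ≤ t → 1 ≤ L → 0 ≤ m →
      (∀ u ∈ Ioo a (a * Real.exp L), m ≤ ρ u) →
      m * L ^ (1 / q₀.toReal) ≤ w t * (C₁ * (D₁ * L ^ (1 / q₁.toReal))) := by
    intro a L t m ha hat hL hm hmu
    obtain ⟨φ, hφ, hN, hlow⟩ := hφ₁ a L ha hL
    have ht : 0 < t := lt_of_lt_of_le (by positivity) hat
    have hwt := hw t ht
    have hL0 : 0 < L := one_pos.trans_le hL
    have h1 := hhead φ hφ _ (by positivity) hN t ht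
    have h2 := (hlow m hm hmu).trans
      (weightedNorm_mono_set (T := Ioo 0 t) _ fun u hu => ⟨ha.trans hu.1, hu.2.trans_le hat⟩)
    have h3 := (mul_le_mul_right h2 (ENNReal.ofReal (w t)⁻¹)).trans h1
    rw [← ENNReal.ofReal_mul (inv_pos.2 hwt).le] at h3
    have h4 := (ENNReal.ofReal_le_ofReal_iff (by positivity)).1 h3
    rwa [inv_mul_le_iff₀ hwt] at h4
  obtain ⟨R, hR, hRle⟩ := hb₀.exists_div_le_rpow_mul hb₁ one_pos
  simp only [Real.rpow_one] at hRle
  set e := Real.exp 1 with he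
  have he0 : 0 < e := Real.exp_pos 1
  have hRe : 0 < R * e := by positivity
  -- Test on `(s, s e)` with `L = 1`; the variation of `ρ` there costs the factor `R * e`.
  have hw_le : ∀ t s, 0 < t → t ≤ s → w t ≤ C₀ * D₀ * (R * e) * ρ s := by
    intro t s ht hts
    have hs := ht.trans_le hts
    have hρs := hρpos s hs
    have := tail s 1 t (R * e * ρ s)⁻¹ ht hts le_rfl (by positivity) fun u hu => by
      have hρu := hρpos u (hs.trans hu.1)
      gcongr
      refine (hRle s u hs hu.1.le).1.trans ?_
      gcongr
      exact (div_le_iff₀ hs).2 (hu.2.le.trans_eq (mul_comm _ _))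
    simp only [Real.one_rpow, mul_one] at this
    rw [← div_eq_mul_inv, div_le_iff₀ (by positivity)] at this
    linarith
  -- Test on `(s / e, s)`, which lies to the left of `t`.
  have le_hw : ∀ s t, 0 < s → s ≤ t → ρ s ≤ R * e * C₁ * D₁ * w t := by
    intro s t hs hst
    have hρs := hρpos s hs
    have hse : s / e * e = s := div_mul_cancel₀ _ he0.ne'
    have := head (s / e) 1 t (ρ s / (R * e)) (by positivity) (by rwa [← he, hse]) le_rfl
      (by positivity) fun u hu => by
        have hu0 : 0 < u := lt_trans (by positivity) hu.1
        have hρu := hρpos u hu0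
        have hus : u < s := hu.2.trans_eq hse
        rw [div_le_iff₀ hRe]
        refine (hRle u s hu0 hus.le).1.trans ?_
        rw [mul_comm (ρ u)]
        gcongr
        exact (div_le_iff₀ hu0).2 (by have := (div_lt_iff₀ he0).1 hu.1; linarith)
    simp only [Real.one_rpow, mul_one] at this
    rw [div_le_iff₀ hRe] at this
    linarith
  obtain ⟨M, hM, hρmono⟩ : ∃ M : ℝ, 0 < M ∧ ∀ s u, 0 < s → s ≤ u → ρ s ≤ M * ρ u := by
    refine ⟨R * e * C₁ * D₁ * (C₀ * D₀ * (R * e)), by positivity, fun s u hs hsu => ?_⟩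
    calc ρ s ≤ R * e * C₁ * D₁ * w s := le_hw s s hs le_rfl
      _ ≤ R * e * C₁ * D₁ * (C₀ * D₀ * (R * e) * ρ u) := by gcongr; exact hw_le s u hs hsu
      _ = _ := by ring
  -- `toReal` sends both `0` and `∞` to `0`, so positivity of the exponents is needed to keep `q =
  -- ∞` apart.
  have hne : 1 / q₀.toReal ≠ 1 / q₁.toReal := by
    intro h
    rw [one_div, one_div, inv_inj] at h
    rcases eq_or_ne q₀ ∞ with rfl | h₀
    · rw [ENNReal.toReal_top, eq_comm, ENNReal.toReal_eq_zero_iff] at h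
      exact h.elim hq₁ fun h => hq h.symm
    rcases eq_or_ne q₁ ∞ with rfl | h₁
    · rw [ENNReal.toReal_top, ENNReal.toReal_eq_zero_iff] at h
      exact h.elim hq₀ hq
    exact hq ((ENNReal.toReal_eq_toReal_iff' h₀ h₁).1 h)
  rcases hne.lt_or_gt with hlt | hlt
  -- For `1/q₀ < 1/q₁` the tail bound at the left endpoint `t = a` produces the growth; in the
  -- opposite case it is the head bound at the right endpoint.
  · refine not_rpow_growth hb₀ hb₁ (sub_pos.2 hlt)
      (B := R * e * C₁ * D₁ * (C₀ * D₀ * M)) fun a L ha hL => ?_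
    have hL0 : 0 < L := one_pos.trans_le hL
    have hd : 0 < a * Real.exp L := by positivity
    have hρd := hρpos _ hd
    have h1 := tail a L a (M * ρ (a * Real.exp L))⁻¹ ha le_rfl hL (by positivity) fun u hu => by
      have hρu := hρpos u (ha.trans hu.1)
      gcongr
      exact hρmono u _ (ha.trans hu.1) hu.2.le
    have h2 : w a * L ^ (1 / q₁.toReal - 1 / q₀.toReal) ≤ C₀ * D₀ * M * ρ (a * Real.exp L) := by
      rw [Real.rpow_sub hL0, ← mul_div_assoc, div_le_iff₀ (by positivity)]
      rw [mul_left_comm, inv_mul_le_iff₀ (by positivity)] at h1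
      linarith
    calc ρ a * L ^ (1 / q₁.toReal - 1 / q₀.toReal)
        ≤ R * e * C₁ * D₁ * w a * L ^ (1 / q₁.toReal - 1 / q₀.toReal) := by
          gcongr; exact le_hw a a ha le_rfl
      _ = R * e * C₁ * D₁ * (w a * L ^ (1 / q₁.toReal - 1 / q₀.toReal)) := by ring
      _ ≤ R * e * C₁ * D₁ * (C₀ * D₀ * M * ρ (a * Real.exp L)) := by gcongr
      _ = _ := by ring
  · refine not_rpow_growth hb₀ hb₁ (sub_pos.2 hlt)
      (B := M * C₁ * D₁ * (C₀ * D₀ * (R * e))) fun a L ha hL => ?_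
    have hL0 : 0 < L := one_pos.trans_le hL
    have hd : 0 < a * Real.exp L := by positivity
    have hρa := hρpos a ha
    have h1 := head a L (a * Real.exp L) (ρ a / M) ha le_rfl hL (by positivity) fun u hu => by
      rw [div_le_iff₀' hM]
      exact hρmono a u ha hu.1.le
    have h2 : ρ a * L ^ (1 / q₀.toReal - 1 / q₁.toReal) ≤
        M * C₁ * D₁ * w (a * Real.exp L) := by
      rw [Real.rpow_sub hL0, ← mul_div_assoc, div_le_iff₀ (by positivity)]
      rw [div_mul_eq_mul_div, div_le_iff₀ hM] at h1
      linarith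
    calc ρ a * L ^ (1 / q₀.toReal - 1 / q₁.toReal) ≤ M * C₁ * D₁ * w (a * Real.exp L) := h2
      _ ≤ M * C₁ * D₁ * (C₀ * D₀ * (R * e) * ρ (a * Real.exp L)) := by
          gcongr; exact hw_le _ _ hd le_rfl
      _ = _ := by ring

end Quotient

/-! ### Endpoint bounds for `K` and transfer to couples. -/

theorem K_le_left {V : Type*} [AddCommGroup V] {N₀ N₁ : V → ℝ≥0∞} (h : N₁ 0 = 0) (t : ℝ) (f : V) : K N₀ N₁ t f ≤ N₀ f :=
  (iInf_le_of_le f (iInf₂_le_of_le 0 (add_zero f).symm le_rfl)).trans (by simp [h])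

theorem K_le_right {V : Type*} [AddCommGroup V] {N₀ N₁ : V → ℝ≥0∞} (h : N₀ 0 = 0) (t : ℝ) (f : V) :
    K N₀ N₁ t f ≤ ENNReal.ofReal t * N₁ f :=
  (iInf_le_of_le 0 (iInf₂_le_of_le f (zero_add f).symm le_rfl)).trans (by simp [h])

section Couple

variable {𝕜 V : Type*} [RCLike 𝕜] [AddCommGroup V] [Module 𝕜 V] [TopologicalSpace V]

theorem QuasiNormedSubspace.extNorm_zero (A : QuasiNormedSubspace 𝕜 V) : A.extNorm 0 = 0 := by
  have h : A.qnorm ⟨0, A.carrier.zero_mem⟩ = 0 := (A.qnorm_eq_zero_iff _).2 rfl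
  simp [QuasiNormedSubspace.extNorm, h]

theorem coupleK_zero (A₀ A₁ : QuasiNormedSubspace 𝕜 V) (t : ℝ) : coupleK A₀ A₁ t 0 = 0 :=
  nonpos_iff_eq_zero.1 ((K_le_left A₁.extNorm_zero t 0).trans A₀.extNorm_zero.le)

theorem interpNorm_zero (A₀ A₁ : QuasiNormedSubspace 𝕜 V) (θ : ℝ) (q : ℝ≥0∞) (b : ℝ → ℝ) :
    interpNorm A₀ A₁ θ q b 0 = 0 := by
  simp [interpNorm, weightedNorm, coupleK_zero]

/-- An `f` with `K(·, f) ≈ φ` carries the hypothesis on elements of the couple over to a bound at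
each `φ`, with a constant depending on `φ`; uniform boundedness removes that dependence. -/
theorem KSurjective.exists_uniform_bound {A₀ A₁ : QuasiNormedSubspace 𝕜 V}
    (hA : KSurjective A₀ A₁) {θ : ℝ} {q : ℝ≥0∞} {b : ℝ → ℝ} (hb : SlowlyVarying b) (hq : q ≠ 0)
    {ι : Type*} (T : ι → (ℝ → ℝ≥0∞) → ℝ≥0∞)
    (hmono : ∀ i k k' c, (∀ u : ℝ, 0 < u → k u ≤ ENNReal.ofReal c * k' u) →
      T i k ≤ ENNReal.ofReal c * T i k')
    {C : ℝ≥0∞} (hC₀ : C ≠ 0) (hC : C ≠ ∞) (hT : ∀ f ∈ A₀.carrier ⊔ A₁.carrier, ∀ i,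
      C * T i (fun u => coupleK A₀ A₁ u f) ≤ interpNorm A₀ A₁ θ q b f) :
    ∃ C : ℝ, 0 < C ∧ ∀ φ, QuasiConcave φ → ∀ N : ℝ, 0 < N →
      weightedNorm θ q b (fun u => ENNReal.ofReal (φ u)) (Ioi 0) ≤ ENNReal.ofReal N →
      ∀ i, T i (fun u => ENNReal.ofReal (φ u)) ≤ ENNReal.ofReal (C * N) := by
  refine KInterpolation.exists_uniform_bound hb hq T hmono fun φ hφ hfin => ?_
  obtain ⟨f, hf, c, hc, c', hc', hcf⟩ := hA φ hφ
  refine ⟨ENNReal.ofReal c⁻¹ * (C⁻¹ * (ENNReal.ofReal c' *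
    weightedNorm θ q b (fun u => ENNReal.ofReal (φ u)) (Ioi 0))),
    ENNReal.mul_ne_top ENNReal.ofReal_ne_top
      (ENNReal.mul_ne_top (ENNReal.inv_ne_top.2 hC₀) (ENNReal.mul_ne_top ENNReal.ofReal_ne_top hfin)), fun i => ?_⟩
  calc T i (fun u => ENNReal.ofReal (φ u))
      ≤ ENNReal.ofReal c⁻¹ * T i (fun u => coupleK A₀ A₁ u f) :=
        hmono i _ _ _ fun u hu => by
          calc ENNReal.ofReal (φ u) = ENNReal.ofReal c⁻¹ * ENNReal.ofReal (c * φ u) := by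
                rw [← ENNReal.ofReal_mul (inv_pos.2 hc).le, inv_mul_cancel_left₀ hc.ne']
            _ ≤ _ := by gcongr; exact (hcf u hu).1
    _ ≤ ENNReal.ofReal c⁻¹ * (C⁻¹ * interpNorm A₀ A₁ θ q b f) := by
      gcongr
      exact (ENNReal.mul_le_iff_le_inv hC₀ hC).1 (hT f hf i)
    _ ≤ _ := by
      gcongr
      exact weightedNorm_le_mul measurableSet_Ioi _ fun u hu => by
        rw [← ENNReal.ofReal_mul hc'.le]
        exact (hcf u hu).2

end Couple

end KInterpolation

/-! ### The main theorem. -/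

theorem mainTheorem5 {𝕜 V : Type*} [RCLike 𝕜] [AddCommGroup V] [Module 𝕜 V]
    [TopologicalSpace V] [IsTopologicalAddGroup V] [ContinuousSMul 𝕜 V] [T2Space V]
    (A₀ A₁ : KInterpolation.QuasiNormedSubspace 𝕜 V)
    (hA : KInterpolation.KSurjective A₀ A₁)
    (θ : ℝ) (hθ₀ : 0 < θ) (hθ₁ : θ < 1)
    (q₀ q₁ : ℝ≥0∞) (hq₀ : 0 < q₀) (hq₁ : 0 < q₁) (hq : q₀ ≠ q₁)
    (b₀ b₁ : ℝ → ℝ) (hb₀ : KInterpolation.SlowlyVarying b₀)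
    (hb₁ : KInterpolation.SlowlyVarying b₁) :
    ¬ ∃ w : ℝ → ℝ, (∀ t : ℝ, 0 < t → 0 < w t) ∧
      ∃ c : ℝ, 0 < c ∧ ∀ f ∈ A₀.carrier ⊔ A₁.carrier, ∀ t : ℝ, 0 < t →
        ENNReal.ofReal c *
            (KInterpolation.weightedNorm θ q₀ b₀
                (fun s => KInterpolation.coupleK A₀ A₁ s f) (Ioo 0 t) +
              ENNReal.ofReal (w t) *
                KInterpolation.weightedNorm θ q₁ b₁
                  (fun s => KInterpolation.coupleK A₀ A₁ s f) (Ioi t)) ≤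
          KInterpolation.K (KInterpolation.interpNorm A₀ A₁ θ q₀ b₀)
            (KInterpolation.interpNorm A₀ A₁ θ q₁ b₁) (w t) f := by
  rintro ⟨w, hw, c, hc, h⟩
  have hc' : ENNReal.ofReal c ≠ 0 := by simpa using hc
  -- Keep only the `(t, ∞)` term and use `f = f + 0`.
  obtain ⟨C₀, hC₀, htail⟩ := hA.exists_uniform_bound (θ := θ) hb₀ hq₀.ne' (ι := Ioi (0 : ℝ))
    (fun t k => ENNReal.ofReal (w t) * KInterpolation.weightedNorm θ q₁ b₁ k (Ioi (t : ℝ)))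
    (fun t k k' r hk => by
      rw [mul_left_comm]
      gcongr
      exact KInterpolation.weightedNorm_le_mul measurableSet_Ioi _
        fun u hu => hk u (lt_trans t.2 hu))
    hc' ENNReal.ofReal_ne_top (fun f hf t => by
      refine le_trans ?_ ((h f hf t t.2).trans
        (KInterpolation.K_le_left (KInterpolation.interpNorm_zero _ _ _ _ _) _ _))
      gcongr
      exact le_add_self)
  -- Keep only the `(0, t)` term, use `f = 0 + f`, and divide by `w t`.
  obtain ⟨C₁, hC₁, hhead⟩ := hA.exists_uniform_bound (θ := θ) hb₁ hq₁.ne' (ι := Ioi (0 : ℝ))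
    (fun t k => ENNReal.ofReal (w t)⁻¹ * KInterpolation.weightedNorm θ q₀ b₀ k (Ioo 0 (t : ℝ)))
    (fun t k k' r hk => by
      rw [mul_left_comm]
      gcongr
      exact KInterpolation.weightedNorm_le_mul measurableSet_Ioo _ fun u hu => hk u hu.1)
    hc' ENNReal.ofReal_ne_top (fun f hf t => by
      have hwt := hw t t.2
      have hwt' : ENNReal.ofReal (w t) ≠ 0 := by simpa using hwt
      have key := (h f hf t t.2).trans
        (KInterpolation.K_le_right (KInterpolation.interpNorm_zero _ _ _ _ _) _ _)
      rw [ENNReal.ofReal_inv_of_pos hwt, mul_left_comm,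
        ENNReal.inv_mul_le_iff hwt' ENNReal.ofReal_ne_top]
      refine le_trans ?_ key
      gcongr
      exact le_self_add)
  exact KInterpolation.false_of_uniform_bounds hb₀ hb₁ hθ₀ hθ₁ hq₀.ne' hq₁.ne' hq hw hC₀ hC₁
    (fun φ hφ N hN hle t ht => htail φ hφ N hN hle ⟨t, ht⟩)
    (fun φ hφ N hN hle t ht => hhead φ hφ N hN hle ⟨t, ht⟩)
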